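/- Let $G$ be a finite digraph (self-loops and multiple arcs allowed) with nonempty vertex set $\{v_1,\dots,v_n\}$ which is strongly connected, i.e. for all $i,j$ (including $i=j$) there is a directed walk of length at least one from $v_i$ to $v_j$. Let $A(G)$ be its adjacency matrix, whose $(i,j)$ entry is the number of arcs from $v_i$ to $v_j$; let $\rho(G)$ be the spectral radius of $A(G)$, and let $h(G)$ be the index of imprimitivity of $G$, i.e. the number of complex eigenvalues of $A(G)$ of modulus $\rho(G)$. For $k\ge 0$ let $d_i^{k+}=\sum_{j=1}^n (A(G)^k)_{ij}$ be the number of directed walks of length $k$ with initial vertex $v_i$ (so $d_i^{0+}=1$). Fix an integer $L>0$ and consider, for integers $k\ge 0$, the bounds $$\min_{1\le i\le n}\left(\frac{d_i^{(k+L)+}}{d_i^{k+}}\right)^{1/L}\ \le\ \rho(G)\ \le\ \max_{1\le i\le n}\left(\frac{d_i^{(k+L)+}}{d_i^{k+}}\right)^{1/L}.\qquad(*)$$ If equality holds on at least one side of $(*)$ for some $k=t\ge 0$, then equality holds on both sides of $(*)$ for all $k\ge t$. Moreover, in that case $\rho(G)$ is the $r$-th root of an integer, that is, $\rho(G)^r\in\mathbb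 Z$, where $r=\gcd(L,h(G))$. -/

import Mathlib

/-! A finite digraph, with loops and multiple arcs allowed, is a `Quiver` on a finite nonempty
vertex type `V` whose arc types `i ⟶ j` are finite. -/

noncomputable section

namespace FinDigraph

/-- The adjacency matrix: the `(i, j)` entry is the number of arcs from `i` to `j`. -/
def adjMatrix (V : Type*) [Quiver V] [∀ i j : V, Fintype (i ⟶ j)] : Matrix V V ℕ :=
  Matrix.of fun i j => Fintype.card (i ⟶ j)

/-- The adjacency matrix, regarded as a complex matrix. -/
def adjMatrixC (V : Type*) [Quiver V] [∀ i j : V, Fintype (i ⟶ j)] : Matrix V V ℂ :=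
  (adjMatrix V).map (fun m : ℕ => (m : ℂ))

variable (V : Type*) [Quiver V] [∀ i j : V, Fintype (i ⟶ j)] [Fintype V] [DecidableEq V]

/-- The `k`-outdegree of a vertex `i`: the number of directed walks of length `k` with initial
vertex `i`, that is, the `i`-th row sum of the `k`-th power of the adjacency matrix
(equal to `1` for `k = 0`). -/
def kOutdegree {V : Type*} [Quiver V] [∀ i j : V, Fintype (i ⟶ j)] [Fintype V] [DecidableEq V]
    (k : ℕ) (i : V) : ℕ :=
  ∑ j, (adjMatrix V ^ k) i j

/-- The spectral radius of a digraph: the largest modulus of a complex eigenvalue of its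
adjacency matrix. -/
def rho : ℝ := (spectralRadius ℂ (adjMatrixC V)).toReal

/-- The index of imprimitivity of a (strongly connected) digraph: the number of complex
eigenvalues of its adjacency matrix whose modulus is equal to the spectral radius. -/
def imprimitivityIndex : ℕ := {z : ℂ | z ∈ spectrum ℂ (adjMatrixC V) ∧ ‖z‖ = rho V}.ncard

/-- The lower bound: the minimum over the vertices `i` of the `L`-th root of the
`(k + L)`-outdegree of `i` divided by the `k`-outdegree of `i`. -/
def lowerBound [Nonempty V] (L k : ℕ) : ℝ :=
  Finset.univ.inf' Finset.univ_nonempty fun i : V =>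
    ((kOutdegree (k + L) i : ℝ) / (kOutdegree k i : ℝ)) ^ (1 / (L : ℝ))

/-- The upper bound: the maximum over the vertices `i` of the `L`-th root of the
`(k + L)`-outdegree of `i` divided by the `k`-outdegree of `i`. -/
def upperBound [Nonempty V] (L k : ℕ) : ℝ :=
  Finset.univ.sup' Finset.univ_nonempty fun i : V =>
    ((kOutdegree (k + L) i : ℝ) / (kOutdegree k i : ℝ)) ^ (1 / (L : ℝ))

end FinDigraph

end

/-!
Let `A` be the adjacency matrix, `ρ` its spectral radius and `d k` the vector of `k`-outdegrees, so
that `A ^ l *ᵥ d k = d (k + l)`. Strong connectivity makes `A` irreducible, so `A` has a positive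
left eigenvector `w`, found by a compactness argument (`Matrix.IsIrreducible.exists_pos_vecMul_eq`),
and its eigenvalue is `ρ` (`Matrix.IsIrreducible.spectralRadius_eq`).

Equality on one side at `t` says that `A ^ L *ᵥ d t` and `ρ ^ L • d t` are comparable; both have the
same pairing with `w`, so they are equal (`FinDigraph.kOutdegree_add_eq`). Multiplying by powers of
`A` gives `A ^ L *ᵥ d k = ρ ^ L • d k` for all `k ≥ t`, which is equality on both sides.

For the arithmetic statement, an eigenvalue `ρ ζ` with `|ζ| = 1` gives a diagonal matrix `D` with
`D⁻¹ A D = ζ A` (`Matrix.IsIrreducible.exists_phase`). Hence the `h` eigenvalues of modulus `ρ` are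
permuted by multiplication by `ζ`, and `ζ ^ h = 1` (`Matrix.IsIrreducible.pow_ncard_eq_one`). The
eigenvalues `ζ` of `ρ⁻¹ A` with `ζ ^ L = 1` therefore satisfy `ζ ^ r = 1` for `r = gcd L h`, so that
`A ^ r *ᵥ d t = ρ ^ r • d t` (`Matrix.IsIrreducible.pow_gcd_mulVec_eq`). As an eigenvalue of an
integer matrix with an integer eigenvector, `ρ ^ r` is both an algebraic integer and rational, hence
an integer (`Matrix.exists_int_eq_of_mulVec_eq`).
-/

open Matrix

/-! ### Vectors and nonnegative matrices -/

namespace Matrix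

variable {n : Type*} [Fintype n]

theorem mem_spectrum_iff_exists_mulVec_eq {K : Type*} [Field K] [DecidableEq n]
    {A : Matrix n n K} {z : K} :
    z ∈ spectrum K A ↔ ∃ y : n → K, y ≠ 0 ∧ A *ᵥ y = z • y := by
  rw [spectrum.mem_iff, isUnit_iff_isUnit_det, isUnit_iff_ne_zero, not_not,
    ← exists_mulVec_eq_zero_iff]
  refine exists_congr fun y => and_congr_right fun _ => ?_
  rw [sub_mulVec, Algebra.algebraMap_eq_smul_one, smul_mulVec, one_mulVec, sub_eq_zero, eq_comm]

theorem pow_mulVec_eq_of_mulVec_eq {R : Type*} [CommRing R] [DecidableEq n]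
    {A : Matrix n n R} {x : n → R} {s : R} (h : A *ᵥ x = s • x) (k : ℕ) :
    A ^ k *ᵥ x = s ^ k • x := by
  induction k with
  | zero => simp
  | succ k ih => rw [pow_succ, ← mulVec_mulVec, h, mulVec_smul, ih, smul_smul, pow_succ']

theorem eq_of_le_of_dotProduct_eq {w a b : n → ℝ} (hw : ∀ i, 0 < w i) (hab : a ≤ b)
    (h : w ⬝ᵥ a = w ⬝ᵥ b) : a = b := by
  have := (Finset.sum_eq_sum_iff_of_le
    (fun i _ => mul_le_mul_of_nonneg_left (hab i) (hw i).le)).1 h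
  ext i
  exact mul_left_cancel₀ (hw i).ne' (this i (Finset.mem_univ i))

theorem mulVec_pos_of_ne_zero {A : Matrix n n ℝ} (hA : ∀ i j, 0 < A i j) {x : n → ℝ}
    (hx : 0 ≤ x) (hx0 : x ≠ 0) (i : n) : 0 < (A *ᵥ x) i := by
  obtain ⟨j, hj⟩ := Function.ne_iff.1 hx0
  exact Finset.sum_pos' (fun j _ => mul_nonneg (hA i j).le (hx j))
    ⟨j, Finset.mem_univ j, mul_pos (hA i j) ((hx j).lt_of_ne' hj)⟩

/-! ### Perron's theorem -/

namespace IsIrreducible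

variable [DecidableEq n] {A : Matrix n n ℝ}

theorem pow_apply_nonneg (hA : A.IsIrreducible) (k : ℕ) (i j : n) : 0 ≤ (A ^ k) i j := by
  induction k generalizing i j with
  | zero => rw [pow_zero, one_apply]; split_ifs <;> simp
  | succ k ih =>
    rw [pow_succ, mul_apply]
    exact Finset.sum_nonneg fun l _ => mul_nonneg (ih i l) (hA.nonneg l j)

theorem exists_pow_apply_pos (hA : A.IsIrreducible) (i j : n) : ∃ k > 0, 0 < (A ^ k) i j :=
  (isIrreducible_iff_exists_pow_pos hA.nonneg).1 hA i j

/-- The sum of sufficiently many powers of an irreducible matrix is entrywise positive. -/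
theorem exists_pos_commute (hA : A.IsIrreducible) :
    ∃ B : Matrix n n ℝ, (∀ i j, 0 < B i j) ∧ Commute A B := by
  choose k _ hk using hA.exists_pow_apply_pos
  let N := Finset.univ.sup fun p : n × n => k p.1 p.2
  refine ⟨∑ m ∈ Finset.range (N + 1), A ^ m, fun i j => ?_,
    Commute.sum_right _ _ _ fun m _ => Commute.self_pow A m⟩
  rw [sum_apply]
  refine Finset.sum_pos' (fun m _ => hA.pow_apply_nonneg m i j) ⟨k i j, ?_, hk i j⟩
  exact Finset.mem_range_succ_iff.2
    (Finset.le_sup (f := fun p : n × n => k p.1 p.2) (Finset.mem_univ (i, j)))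

/-- A nonnegative eigenvector of an irreducible matrix is positive, and so is its eigenvalue. -/
theorem pos_of_mulVec_eq (hA : A.IsIrreducible) {x : n → ℝ} {s : ℝ} (hx : 0 ≤ x) (hx0 : x ≠ 0)
    (h : A *ᵥ x = s • x) : 0 < s ∧ ∀ i, 0 < x i := by
  obtain ⟨j, hj⟩ := Function.ne_iff.1 hx0
  have key : ∀ i, ∃ k > 0, 0 < s ^ k * x i := fun i => by
    obtain ⟨k, hk0, hk⟩ := hA.exists_pow_apply_pos i j
    refine ⟨k, hk0, ?_⟩
    have h1 : 0 < (A ^ k *ᵥ x) i := Finset.sum_pos'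
      (fun l _ => mul_nonneg (hA.pow_apply_nonneg k i l) (hx l))
      ⟨j, Finset.mem_univ j, mul_pos hk ((hx j).lt_of_ne' hj)⟩
    rwa [pow_mulVec_eq_of_mulVec_eq h] at h1
  have hpos : ∀ i, 0 < x i := fun i => by
    obtain ⟨k, _, hk⟩ := key i
    exact (hx i).lt_of_ne' (right_ne_zero_of_mul hk.ne')
  refine ⟨?_, hpos⟩
  obtain ⟨k, hk0, hk⟩ := key j
  have hs : s ≠ 0 := fun hs => by simp [hs, hk0.ne'] at hk
  have : 0 ≤ s * x j := by
    have h2 : (A *ᵥ x) j = s * x j := by rw [h]; rfl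
    rw [← h2]
    exact Finset.sum_nonneg fun l _ => mul_nonneg (hA.nonneg j l) (hx l)
  exact (nonneg_of_mul_nonneg_left this (hpos j)).lt_of_ne' hs

/-- If `s` is a lower Collatz–Wielandt value of `x` which is not attained in every coordinate,
then some positive vector has a strictly larger value. -/
theorem exists_smul_le_mulVec_of_ne (hA : A.IsIrreducible) {x : n → ℝ} {s : ℝ}
    (hx : 0 ≤ x) (hx0 : x ≠ 0) (h : s • x ≤ A *ᵥ x) (hne : s • x ≠ A *ᵥ x) :
    ∃ u : n → ℝ, ∃ s' > s, (∀ i, 0 < u i) ∧ s' • u ≤ A *ᵥ u := by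
  obtain ⟨B, hB, hAB⟩ := hA.exists_pos_commute
  have hu := mulVec_pos_of_ne_zero hB hx hx0
  have hz := mulVec_pos_of_ne_zero hB (sub_nonneg.2 h) (sub_ne_zero.2 hne.symm)
  have hAu : A *ᵥ (B *ᵥ x) = B *ᵥ (A *ᵥ x - s • x) + s • (B *ᵥ x) := by
    rw [mulVec_sub, mulVec_smul, mulVec_mulVec, mulVec_mulVec, hAB.eq]; abel
  obtain ⟨i₀, -⟩ := Function.ne_iff.1 hx0
  obtain ⟨i, -, hi⟩ := Finset.exists_min_image Finset.univ
    (fun i => (A *ᵥ (B *ᵥ x)) i / (B *ᵥ x) i) ⟨i₀, Finset.mem_univ i₀⟩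
  refine ⟨B *ᵥ x, (A *ᵥ (B *ᵥ x)) i / (B *ᵥ x) i, ?_, hu, fun j => ?_⟩
  · rw [gt_iff_lt, lt_div_iff₀ (hu i), hAu]
    simpa using hz i
  · exact (le_div_iff₀ (hu j)).1 (hi j (Finset.mem_univ j))

/-- **Perron's theorem**: an irreducible matrix has a positive eigenvector. It is found by
maximising `s` over the compact set of pairs `(x, s)` with `x` in the standard simplex, `0 ≤ s`
and `s • x ≤ A *ᵥ x`. -/
theorem exists_pos_mulVec_eq [Nonempty n] (hA : A.IsIrreducible) :
    ∃ x : n → ℝ, ∃ s : ℝ, 0 < s ∧ (∀ i, 0 < x i) ∧ A *ᵥ x = s • x := by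
  set C := ∑ i, ∑ j, A i j with hC
  have bound : ∀ x ∈ stdSimplex ℝ n, ∀ s : ℝ, s • x ≤ A *ᵥ x → s ≤ C := fun x hx s h => by
    calc s = ∑ i, (s • x) i := by simp [← Finset.mul_sum, hx.2]
      _ ≤ ∑ i, (A *ᵥ x) i := Finset.sum_le_sum fun i _ => h i
      _ ≤ C := Finset.sum_le_sum fun i _ => Finset.sum_le_sum fun j _ => by
        refine mul_le_of_le_one_right (hA.nonneg i j) ?_
        rw [← hx.2]
        exact Finset.single_le_sum (fun l _ => hx.1 l) (Finset.mem_univ j)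
  let S : Set ((n → ℝ) × ℝ) :=
    (stdSimplex ℝ n ×ˢ Set.Icc 0 C) ∩ {p | p.2 • p.1 ≤ A *ᵥ p.1}
  have hS : IsCompact S := by
    refine ((isCompact_stdSimplex ℝ n).prod isCompact_Icc).inter_right (isClosed_le ?_ ?_)
    · fun_prop
    · fun_prop
  have hS0 : S.Nonempty := by
    obtain ⟨i⟩ := ‹Nonempty n›
    refine ⟨(Pi.single i 1, 0), ⟨single_mem_stdSimplex ℝ i, le_rfl, ?_⟩, ?_⟩
    · exact Finset.sum_nonneg fun i _ => Finset.sum_nonneg fun j _ => hA.nonneg i j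
    · intro j
      simpa using hA.nonneg j i
  obtain ⟨⟨x, s⟩, ⟨⟨hx, hs⟩, hxs⟩, hmax⟩ := hS.exists_isMaxOn hS0 continuous_snd.continuousOn
  have hx0 : x ≠ 0 := fun h => by simpa [h] using hx.2
  have heq : s • x = A *ᵥ x := by
    by_contra hne
    -- Otherwise the normalisation of a better vector contradicts maximality.
    obtain ⟨u, s', hs', hu, hus⟩ := hA.exists_smul_le_mulVec_of_ne hx.1 hx0 hxs hne
    have hσ : 0 < ∑ i, u i := Finset.sum_pos (fun i _ => hu i) Finset.univ_nonempty
    have hv : (∑ i, u i)⁻¹ • u ∈ stdSimplex ℝ n :=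
      ⟨fun i => mul_nonneg (inv_nonneg.2 hσ.le) (hu i).le, by
        simp [← Finset.mul_sum, hσ.ne']⟩
    have hvs : s' • (∑ i, u i)⁻¹ • u ≤ A *ᵥ ((∑ i, u i)⁻¹ • u) := by
      rw [mulVec_smul, smul_comm]
      exact smul_le_smul_of_nonneg_left hus (inv_nonneg.2 hσ.le)
    have hmem : ((∑ i, u i)⁻¹ • u, s') ∈ S :=
      ⟨⟨hv, hs.1.trans hs'.le, bound _ hv _ hvs⟩, hvs⟩
    exact absurd (hmax hmem) (not_le.2 hs')
  obtain ⟨h1, h2⟩ := hA.pos_of_mulVec_eq hx.1 hx0 heq.symm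
  exact ⟨x, s, h1, h2, heq.symm⟩

theorem exists_pos_vecMul_eq [Nonempty n] (hA : A.IsIrreducible) :
    ∃ w : n → ℝ, ∃ s : ℝ, 0 < s ∧ (∀ i, 0 < w i) ∧ w ᵥ* A = s • w := by
  obtain ⟨w, s, hs, hw, h⟩ := hA.transpose.exists_pos_mulVec_eq
  exact ⟨w, s, hs, hw, by rwa [mulVec_transpose] at h⟩

end IsIrreducible

/-- Pairing with a positive left eigenvector shows that a subinvariant vector is an eigenvector. -/
theorem mulVec_eq_of_smul_le {A : Matrix n n ℝ} {w x : n → ℝ} {s : ℝ}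
    (hw : ∀ i, 0 < w i) (h : w ᵥ* A = s • w) (hx : s • x ≤ A *ᵥ x) : A *ᵥ x = s • x :=
  (eq_of_le_of_dotProduct_eq hw hx (by
    rw [dotProduct_mulVec, h, smul_dotProduct, dotProduct_smul])).symm

theorem mulVec_eq_of_le_smul {A : Matrix n n ℝ} {w x : n → ℝ} {s : ℝ}
    (hw : ∀ i, 0 < w i) (h : w ᵥ* A = s • w) (hx : A *ᵥ x ≤ s • x) : A *ᵥ x = s • x :=
  eq_of_le_of_dotProduct_eq hw hx (by
    rw [dotProduct_mulVec, h, smul_dotProduct, dotProduct_smul])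

/-- The triangle inequality applied to an eigenvector of a nonnegative matrix. -/
theorem norm_smul_norm_le_mulVec {A : Matrix n n ℝ} (hA : ∀ i j, 0 ≤ A i j) {y : n → ℂ} {z : ℂ}
    (h : A.map Complex.ofReal *ᵥ y = z • y) :
    ‖z‖ • (fun i => ‖y i‖) ≤ A *ᵥ fun i => ‖y i‖ := fun i => by
  calc ‖z‖ * ‖y i‖ = ‖(A.map Complex.ofReal *ᵥ y) i‖ := by rw [h]; simp
    _ ≤ ∑ j, ‖(A i j : ℂ) * y j‖ := norm_sum_le _ _
    _ = ∑ j, A i j * ‖y j‖ := Finset.sum_congr rfl fun j _ => by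
      rw [norm_mul, Complex.norm_real, Real.norm_of_nonneg (hA i j)]

theorem map_ofReal_mulVec (A : Matrix n n ℝ) (x : n → ℝ) :
    (A.map Complex.ofReal *ᵥ fun i => (x i : ℂ)) = fun i => (((A *ᵥ x) i : ℝ) : ℂ) := by
  ext i; simp [mulVec, dotProduct]

/-! ### Spectral radius and eigenvalues of maximal modulus -/

namespace IsIrreducible

variable [DecidableEq n] {A : Matrix n n ℝ}

/-- The spectral radius of an irreducible matrix is the eigenvalue of each positive left
eigenvector: pairing that vector with `‖z‖ • |y| ≤ A *ᵥ |y|` bounds every eigenvalue `z`. -/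
theorem spectralRadius_eq [Nonempty n] (hA : A.IsIrreducible) {w : n → ℝ} {s : ℝ} (hs : 0 < s)
    (hw : ∀ i, 0 < w i) (h : w ᵥ* A = s • w) :
    (spectralRadius ℂ (A.map Complex.ofReal)).toReal = s := by
  obtain ⟨x, s', -, hx, hxs⟩ := hA.exists_pos_mulVec_eq
  have hwx : ∀ y : n → ℝ, 0 ≤ y → y ≠ 0 → 0 < w ⬝ᵥ y := fun y hy hy0 => by
    obtain ⟨j, hj⟩ := Function.ne_iff.1 hy0
    exact Finset.sum_pos' (fun i _ => mul_nonneg (hw i).le (hy i))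
      ⟨j, Finset.mem_univ j, mul_pos (hw j) ((hy j).lt_of_ne' hj)⟩
  have hx0 : x ≠ 0 := fun h0 => by
    obtain ⟨i⟩ := ‹Nonempty n›
    simpa [h0] using hx i
  have hss : s' = s := by
    have h1 : w ⬝ᵥ (A *ᵥ x) = s * (w ⬝ᵥ x) := by
      rw [dotProduct_mulVec, h, smul_dotProduct, smul_eq_mul]
    rw [hxs, dotProduct_smul, smul_eq_mul] at h1
    exact mul_right_cancel₀ (hwx x (fun i => (hx i).le) hx0).ne' h1
  subst hss
  have hmem : (s' : ℂ) ∈ spectrum ℂ (A.map Complex.ofReal) := by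
    refine mem_spectrum_iff_exists_mulVec_eq.2 ⟨fun i => (x i : ℂ), fun h0 => hx0 ?_, ?_⟩
    · ext i; simpa using congrFun h0 i
    · rw [map_ofReal_mulVec, hxs]; ext i; simp
  have hle : ∀ z ∈ spectrum ℂ (A.map Complex.ofReal), ‖z‖ ≤ s' := fun z hz => by
    obtain ⟨y, hy0, hy⟩ := mem_spectrum_iff_exists_mulVec_eq.1 hz
    have h1 := norm_smul_norm_le_mulVec hA.nonneg hy
    have h2 : w ⬝ᵥ (‖z‖ • fun i => ‖y i‖) ≤ w ⬝ᵥ (A *ᵥ fun i => ‖y i‖) :=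
      Finset.sum_le_sum fun i _ => mul_le_mul_of_nonneg_left (h1 i) (hw i).le
    rw [dotProduct_mulVec, h, smul_dotProduct, dotProduct_smul] at h2
    refine le_of_mul_le_mul_right h2 (hwx _ (fun i => norm_nonneg _) fun h0 => hy0 ?_)
    ext i; simpa using congrFun h0 i
  have : spectralRadius ℂ (A.map Complex.ofReal) = ENNReal.ofReal s' := by
    refine le_antisymm (iSup₂_le fun z hz => ?_) ?_
    · rw [← enorm_eq_nnnorm, ← ofReal_norm]
      exact ENNReal.ofReal_le_ofReal (hle z hz)
    · refine le_of_eq_of_le ?_ (le_iSup₂ (f := fun (z : ℂ) _ => (‖z‖₊ : ENNReal)) _ hmem)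
      rw [← enorm_eq_nnnorm, ← ofReal_norm, Complex.norm_real, Real.norm_of_nonneg hs.le]
  rw [this, ENNReal.toReal_ofReal hs.le]

theorem exists_pos_vecMul_eq_spectralRadius [Nonempty n] (hA : A.IsIrreducible) :
    0 < (spectralRadius ℂ (A.map Complex.ofReal)).toReal ∧ ∃ w : n → ℝ, (∀ i, 0 < w i) ∧
      w ᵥ* A = (spectralRadius ℂ (A.map Complex.ofReal)).toReal • w := by
  obtain ⟨w, s, hs, hw, h⟩ := hA.exists_pos_vecMul_eq
  rw [hA.spectralRadius_eq hs hw h]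
  exact ⟨hs, w, hw, h⟩

/-- **Wielandt's lemma**: an eigenvalue `ρ ζ` of maximal modulus yields a unimodular diagonal
matrix `D` with `A D = ζ D A`, namely the phases of an eigenvector. -/
theorem exists_phase [Nonempty n] (hA : A.IsIrreducible) {w : n → ℝ} {s : ℝ} (hs : 0 < s)
    (hw : ∀ i, 0 < w i) (h : w ᵥ* A = s • w) {ζ : ℂ} (hζ : ‖ζ‖ = 1)
    (hmem : (s : ℂ) * ζ ∈ spectrum ℂ (A.map Complex.ofReal)) :
    ∃ d : n → ℂ, (∀ i, d i ≠ 0) ∧ ∀ i j, (A i j : ℂ) * d j = ζ * d i * A i j := by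
  obtain ⟨y, hy0, hy⟩ := mem_spectrum_iff_exists_mulVec_eq.1 hmem
  have h1 := norm_smul_norm_le_mulVec hA.nonneg hy
  rw [norm_mul, hζ, mul_one, Complex.norm_real, Real.norm_of_nonneg hs.le] at h1
  have h2 := mulVec_eq_of_smul_le hw h h1
  have hpos := (hA.pos_of_mulVec_eq (fun i => norm_nonneg _)
    (fun h0 => hy0 (by ext i; simpa using congrFun h0 i)) h2).2
  have hyi : ∀ i, y i ≠ 0 := fun i => norm_pos_iff.1 (hpos i)
  refine ⟨fun i => y i / ‖y i‖,
    fun i => div_ne_zero (hyi i) (Complex.ofReal_ne_zero.2 (hpos i).ne'), fun i j => ?_⟩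
  -- `c` undoes the phase of the `i`-th coordinate of `A *ᵥ y`.
  set c : ℂ := (starRingEnd ℂ) (ζ * (y i / ‖y i‖)) with hc
  have hn : ‖ζ * (y i / ‖y i‖)‖ = 1 := by
    rw [norm_mul, hζ, norm_div, Complex.norm_real, norm_norm, div_self (hpos i).ne', mul_one]
  have hcn : ‖c‖ = 1 := by rw [hc, RCLike.norm_conj, hn]
  have hcc : ζ * (y i / ‖y i‖) * c = 1 := by
    rw [hc, Complex.mul_conj, Complex.normSq_eq_norm_sq, hn]; simp
  have hsum : ∑ j, A i j * (c * y j).re = ∑ j, A i j * ‖y j‖ := by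
    have e1 : c * (A.map Complex.ofReal *ᵥ y) i = ((s * ‖y i‖ : ℝ) : ℂ) := by
      have hne : (‖y i‖ : ℂ) ≠ 0 := Complex.ofReal_ne_zero.2 (hpos i).ne'
      rw [hy, Pi.smul_apply, smul_eq_mul]
      calc c * (s * ζ * y i) = s * ‖y i‖ * (ζ * (y i / ‖y i‖) * c) := by field_simp
        _ = _ := by rw [hcc]; push_cast; ring
    have e2 : (∑ j, A i j * (c * y j).re) = (c * (A.map Complex.ofReal *ᵥ y) i).re := by
      simp only [mulVec, dotProduct, map_apply, Finset.mul_sum, Complex.re_sum]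
      refine Finset.sum_congr rfl fun j _ => ?_
      rw [mul_left_comm, Complex.re_ofReal_mul]
    rw [e2, e1, Complex.ofReal_re]
    exact (congrFun h2 i).symm
  have hle : ∀ j, (c * y j).re ≤ ‖y j‖ := fun j => by
    simpa [hcn] using Complex.re_le_norm (c * y j)
  have hj := (Finset.sum_eq_sum_iff_of_le fun j _ =>
    mul_le_mul_of_nonneg_left (hle j) (hA.nonneg i j)).1 hsum j (Finset.mem_univ j)
  rcases eq_or_ne (A i j) 0 with h0 | h0
  · simp [h0]
  have hre : (c * y j).re = ‖c * y j‖ := by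
    rw [norm_mul, hcn, one_mul]; exact mul_left_cancel₀ h0 hj
  have hcy : c * y j = ‖y j‖ := by
    have := Complex.eq_coe_norm_of_nonneg (Complex.re_eq_norm.1 hre)
    rwa [norm_mul, hcn, one_mul] at this
  have hyj : y j = ζ * (y i / ‖y i‖) * ‖y j‖ := by
    rw [← hcy, ← mul_assoc, hcc, one_mul]
  have hne : (‖y j‖ : ℂ) ≠ 0 := Complex.ofReal_ne_zero.2 (hpos j).ne'
  have : y j / ‖y j‖ = ζ * (y i / ‖y i‖) := by
    rw [div_eq_iff hne]; exact hyj
  change (A i j : ℂ) * (y j / ‖y j‖) = ζ * (y i / ‖y i‖) * A i j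
  rw [this, mul_comm]

/-- The normalised eigenvalues of maximal modulus are closed under multiplication. Being `h` in
number, they are `h`-th roots of unity. -/
theorem pow_ncard_eq_one [Nonempty n] (hA : A.IsIrreducible) {w : n → ℝ} {s : ℝ} (hs : 0 < s)
    (hw : ∀ i, 0 < w i) (h : w ᵥ* A = s • w) {ζ : ℂ} (hζ : ‖ζ‖ = 1)
    (hmem : (s : ℂ) * ζ ∈ spectrum ℂ (A.map Complex.ofReal)) :
    ζ ^ {z : ℂ | z ∈ spectrum ℂ (A.map Complex.ofReal) ∧ ‖z‖ = s}.ncard = 1 := by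
  obtain ⟨d, hd, hAd⟩ := hA.exists_phase hs hw h hζ hmem
  have hζ0 : ζ ≠ 0 := norm_ne_zero_iff.1 (by rw [hζ]; exact one_ne_zero)
  set H := {z : ℂ | z ∈ spectrum ℂ (A.map Complex.ofReal) ∧ ‖z‖ = s} with hH
  have hfin : H.Finite := (Matrix.finite_spectrum _).subset fun z hz => hz.1
  have hmaps : ∀ z ∈ H, ζ * z ∈ H := fun z hz => by
    obtain ⟨y, hy0, hy⟩ := mem_spectrum_iff_exists_mulVec_eq.1 hz.1
    refine ⟨mem_spectrum_iff_exists_mulVec_eq.2 ⟨fun j => d j * y j, fun h0 => hy0 ?_, ?_⟩, ?_⟩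
    · ext i; simpa [hd i] using congrFun h0 i
    · ext i
      have hi : ∑ j, (A i j : ℂ) * y j = z * y i := congrFun hy i
      calc ∑ j, (A i j : ℂ) * (d j * y j) = ∑ j, ζ * d i * ((A i j : ℂ) * y j) :=
            Finset.sum_congr rfl fun j _ => by rw [← mul_assoc, hAd, mul_assoc]
        _ = ζ * z * (d i * y i) := by rw [← Finset.mul_sum, hi]; ring
    · rw [norm_mul, hζ, one_mul, hz.2]
  have himg : hfin.toFinset.image (ζ * ·) = hfin.toFinset := by
    refine Finset.eq_of_subset_of_card_le (fun z hz => ?_) ?_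
    · obtain ⟨z', hz', rfl⟩ := Finset.mem_image.1 hz
      exact hfin.mem_toFinset.2 (hmaps z' (hfin.mem_toFinset.1 hz'))
    · rw [Finset.card_image_of_injective _ (mul_right_injective₀ hζ0)]
  -- Comparing the products over `H` and over `ζ H = H` gives `ζ ^ h = 1`.
  have hprod : ζ ^ hfin.toFinset.card * ∏ z ∈ hfin.toFinset, z = ∏ z ∈ hfin.toFinset, z := by
    conv_rhs => rw [← himg]
    rw [Finset.prod_image fun a _ b _ hab => mul_right_injective₀ hζ0 hab,
      Finset.prod_mul_distrib, Finset.prod_const]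
  have hne : ∏ z ∈ hfin.toFinset, z ≠ 0 := Finset.prod_ne_zero_iff.2 fun z hz => by
    have := (hfin.mem_toFinset.1 hz).2
    exact norm_ne_zero_iff.1 (by rw [this]; exact hs.ne')
  rw [Set.ncard_eq_toFinset_card H hfin]
  exact mul_right_cancel₀ hne (hprod.trans (one_mul _).symm)

end IsIrreducible

end Matrix

/-! ### From the `L`-th power to the power `gcd L h`, and integrality -/

namespace Matrix

variable {n : Type*} [Fintype n] [DecidableEq n] {A : Matrix n n ℝ}

open Polynomial in
/-- An eigenvector of `A ^ L` for `ρ ^ L` is already one of `A ^ gcd L h`: otherwise the cofactor of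
`X ^ gcd L h - 1` in `X ^ L - 1` would vanish at an eigenvalue `ζ` of `ρ⁻¹ A`, whereas each such `ζ`
with `ζ ^ L = 1` also satisfies `ζ ^ h = 1`. -/
theorem IsIrreducible.pow_gcd_mulVec_eq [Nonempty n] (hA : A.IsIrreducible) {w x : n → ℝ} {s : ℝ}
    (hs : 0 < s) (hw : ∀ i, 0 < w i) (h : w ᵥ* A = s • w) {L : ℕ} (hL : 0 < L)
    (hx : A ^ L *ᵥ x = s ^ L • x) {r : ℕ}
    (hr : r = L.gcd {z : ℂ | z ∈ spectrum ℂ (A.map Complex.ofReal) ∧ ‖z‖ = s}.ncard) :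
    A ^ r *ᵥ x = s ^ r • x := by
  have hs0 : (s : ℂ) ≠ 0 := Complex.ofReal_ne_zero.2 hs.ne'
  have hrL : r ∣ L := hr ▸ Nat.gcd_dvd_left _ _
  have hr0 : 0 < r := Nat.pos_of_dvd_of_pos hrL hL
  have hmap : ∀ k : ℕ, (A.map Complex.ofReal) ^ k = (A ^ k).map Complex.ofReal := fun k =>
    (map_pow Complex.ofRealHom.mapMatrix A k).symm
  set M : Matrix n n ℂ := (s : ℂ)⁻¹ • A.map Complex.ofReal with hM
  set y : n → ℂ := fun i => (x i : ℂ) with hy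
  have hpow : ∀ k : ℕ, M ^ k *ᵥ y = fun i => (((s ^ k)⁻¹ * (A ^ k *ᵥ x) i : ℝ) : ℂ) := fun k => by
    rw [hM, _root_.smul_pow, hmap, smul_mulVec, map_ofReal_mulVec]
    ext i; simp
  set p : ℂ[X] := ∑ i ∈ Finset.range (L / r), (X ^ r) ^ i with hp
  have hpX : p * (X ^ r - 1) = X ^ L - 1 := by
    rw [hp, geom_sum_mul, ← pow_mul, Nat.mul_div_cancel' hrL]
  have hpM : aeval M p * (M ^ r - 1) = M ^ L - 1 := by
    simpa using congrArg (aeval M) hpX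
  have hy0 : (M ^ r - 1) *ᵥ y = 0 := by
    by_contra hne
    have h0 : (0 : ℂ) ∈ spectrum ℂ (aeval M p) := by
      refine mem_spectrum_iff_exists_mulVec_eq.2 ⟨_, hne, ?_⟩
      rw [mulVec_mulVec, hpM, sub_mulVec, hpow, hx, one_mulVec, zero_smul, sub_eq_zero]
      ext i
      simp [hy, hs0]
    rw [spectrum.map_polynomial_aeval_of_nonempty M p
      (spectrum.nonempty_of_isAlgClosed_of_finiteDimensional ℂ M)] at h0
    obtain ⟨ζ, hζ, hpζ : eval ζ p = 0⟩ := h0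
    have hζL : ζ ^ L = 1 := by
      have := congrArg (eval ζ) hpX
      rw [eval_mul, hpζ, zero_mul] at this
      simpa using (sub_eq_zero.1 (by simpa using this.symm : ζ ^ L - 1 = 0))
    have hmem : (s : ℂ) * ζ ∈ spectrum ℂ (A.map Complex.ofReal) := by
      obtain ⟨v, hv0, hv⟩ := mem_spectrum_iff_exists_mulVec_eq.1 hζ
      refine mem_spectrum_iff_exists_mulVec_eq.2 ⟨v, hv0, ?_⟩
      rw [mul_smul, ← hv, hM, smul_mulVec, smul_inv_smul₀ hs0]
    have hζh := hA.pow_ncard_eq_one hs hw h (Complex.norm_eq_one_of_pow_eq_one hζL hL.ne') hmem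
    have hζr : ζ ^ r = 1 := by
      rw [hr, ← orderOf_dvd_iff_pow_eq_one]
      exact Nat.dvd_gcd (orderOf_dvd_of_pow_eq_one hζL) (orderOf_dvd_of_pow_eq_one hζh)
    have : ((L / r : ℕ) : ℂ) = 0 := by
      rw [← hpζ, hp]; simp [eval_finsetSum, hζr]
    exact (Nat.div_pos (Nat.le_of_dvd hL hrL) hr0).ne' (by exact_mod_cast this)
  rw [sub_mulVec, one_mulVec, sub_eq_zero, hpow] at hy0
  ext i
  have hi : (s ^ r)⁻¹ * (A ^ r *ᵥ x) i = x i := Complex.ofReal_injective (congrFun hy0 i)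
  rw [Pi.smul_apply, smul_eq_mul, ← hi, mul_inv_cancel_left₀ (pow_pos hs r).ne']

/-- A real eigenvalue of an integer matrix is an algebraic integer; if it has a nonzero integer
eigenvector it is also rational, hence an integer. -/
theorem exists_int_eq_of_mulVec_eq {N : Matrix n n ℤ} {x : n → ℤ} (hx0 : x ≠ 0) {a : ℝ}
    (h : N.map (Int.cast : ℤ → ℝ) *ᵥ (fun i => (x i : ℝ)) = a • fun i => (x i : ℝ)) :
    ∃ m : ℤ, a = m := by
  obtain ⟨i, hi⟩ := Function.ne_iff.1 hx0
  have hi' : (x i : ℝ) ≠ 0 := Int.cast_ne_zero.2 hi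
  have hdet : (algebraMap ℝ (Matrix n n ℝ) a - N.map (Int.cast : ℤ → ℝ)).det = 0 := by
    refine exists_mulVec_eq_zero_iff.1 ⟨fun i => (x i : ℝ), fun h0 => hi' (congrFun h0 i), ?_⟩
    rw [sub_mulVec, h, Algebra.algebraMap_eq_smul_one, smul_mulVec, one_mulVec, sub_self]
  have hint : IsIntegral ℤ a := by
    refine ⟨N.charpoly, N.charpoly_monic, ?_⟩
    rw [← Polynomial.eval_map, ← charpoly_map, eval_charpoly]
    exact hdet
  have hq : a = algebraMap ℚ ℝ (((N *ᵥ x) i : ℚ) / x i) := by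
    have e : (((N *ᵥ x) i : ℤ) : ℝ) = a * x i := by
      rw [← smul_eq_mul, ← Pi.smul_apply (f := fun i => (x i : ℝ)), ← h]
      simp [mulVec, dotProduct]
    simp only [eq_ratCast, Rat.cast_div, Rat.cast_intCast]
    rw [e, mul_div_cancel_right₀ _ hi']
  rw [hq, isIntegral_algebraMap_iff (algebraMap ℚ ℝ).injective] at hint
  obtain ⟨m, hm⟩ := IsIntegrallyClosed.isIntegral_iff.1 hint
  exact ⟨m, by rw [hq, ← hm]; simp⟩

end Matrix

/-! ### Outdegrees of strongly connected digraphs -/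

namespace FinDigraph

variable {V : Type*} [Quiver V] [∀ i j : V, Fintype (i ⟶ j)]

/-- The adjacency matrix, regarded as a real matrix. -/
def adjMatrixR (V : Type*) [Quiver V] [∀ i j : V, Fintype (i ⟶ j)] : Matrix V V ℝ :=
  (adjMatrix V).map (Nat.cast : ℕ → ℝ)

theorem adjMatrixC_eq_map_adjMatrixR : adjMatrixC V = (adjMatrixR V).map Complex.ofReal := by
  ext i j; simp [adjMatrixC, adjMatrixR]

variable [Fintype V] [DecidableEq V]

theorem adjMatrix_pow_apply_pos {i j : V} (p : Quiver.Path i j) :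
    0 < (adjMatrix V ^ p.length) i j := by
  induction p with
  | nil => simp
  | @cons l m p e ih =>
    rw [Quiver.Path.length_cons, pow_succ, mul_apply]
    exact Finset.sum_pos' (fun _ _ => Nat.zero_le _)
      ⟨l, Finset.mem_univ l, Nat.mul_pos ih (Fintype.card_pos_iff.2 ⟨e⟩)⟩

theorem adjMatrixR_pow (k : ℕ) : adjMatrixR V ^ k = (adjMatrix V ^ k).map (Nat.cast : ℕ → ℝ) :=
  (map_pow (Nat.castRingHom ℝ).mapMatrix (adjMatrix V) k).symm

theorem isIrreducible_adjMatrixR (hG : Quiver.IsSStronglyConnected V) :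
    (adjMatrixR V).IsIrreducible := by
  have hnn : ∀ i j, 0 ≤ adjMatrixR V i j := fun i j => Nat.cast_nonneg (adjMatrix V i j)
  refine (isIrreducible_iff_exists_pow_pos hnn).2 fun i j => ?_
  obtain ⟨p, hp⟩ := hG i j
  refine ⟨p.length, hp, ?_⟩
  rw [adjMatrixR_pow]
  exact Nat.cast_pos.2 (adjMatrix_pow_apply_pos p)

theorem kOutdegree_add (k l : ℕ) (i : V) :
    kOutdegree (k + l) i = ((adjMatrix V ^ l) *ᵥ kOutdegree k) i := by
  simp only [kOutdegree, add_comm k l, pow_add, mul_apply, mulVec, dotProduct, Finset.mul_sum]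
  exact Finset.sum_comm

theorem adjMatrixR_pow_mulVec_kOutdegree (k l : ℕ) :
    (adjMatrixR V ^ l *ᵥ fun i => (kOutdegree k i : ℝ)) = fun i => (kOutdegree (k + l) i : ℝ) := by
  ext i
  rw [kOutdegree_add, adjMatrixR_pow]
  simp [mulVec, dotProduct]

/-- Every walk extends to a longer one because some arc leaves its end. -/
theorem kOutdegree_pos (hG : Quiver.IsSStronglyConnected V) (k : ℕ) (i : V) :
    0 < kOutdegree k i := by
  have hex : ∀ j : V, ∃ m, 0 < adjMatrix V j m := fun j => by
    by_contra! h0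
    obtain ⟨p, hp⟩ := hG j j
    have h1 := adjMatrix_pow_apply_pos p
    obtain ⟨k, hk⟩ := Nat.exists_eq_succ_of_ne_zero hp.ne'
    rw [hk, pow_succ', mul_apply] at h1
    simp [Nat.le_zero.1 (h0 _)] at h1
  induction k generalizing i with
  | zero => simp [kOutdegree, one_apply]
  | succ k ih =>
    rw [kOutdegree_add, pow_one]
    obtain ⟨m, hm⟩ := hex i
    exact Finset.sum_pos' (fun _ _ => Nat.zero_le _)
      ⟨m, Finset.mem_univ m, Nat.mul_pos hm (ih m)⟩

theorem exists_pos_vecMul_adjMatrixR_eq_rho [Nonempty V] (hG : Quiver.IsSStronglyConnected V) :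
    0 < rho V ∧ ∃ w : V → ℝ, (∀ i, 0 < w i) ∧ w ᵥ* adjMatrixR V = rho V • w := by
  rw [rho, adjMatrixC_eq_map_adjMatrixR]
  exact (isIrreducible_adjMatrixR hG).exists_pos_vecMul_eq_spectralRadius

/-- Equality on one side of the bounds makes the vector of `t`-outdegrees an eigenvector of the
`L`-th power of the adjacency matrix: pair the inequality with a positive left eigenvector. -/
theorem kOutdegree_add_eq [Nonempty V] (hG : Quiver.IsSStronglyConnected V) {L : ℕ} (hL : 0 < L)
    {t : ℕ} (ht : lowerBound V L t = rho V ∨ rho V = upperBound V L t) :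
    (adjMatrixR V ^ L *ᵥ fun i => (kOutdegree t i : ℝ)) =
      rho V ^ L • fun i => (kOutdegree t i : ℝ) := by
  obtain ⟨hρ, w, hw, h⟩ := exists_pos_vecMul_adjMatrixR_eq_rho hG
  have hd : ∀ i : V, (0 : ℝ) < kOutdegree t i := fun i => Nat.cast_pos.2 (kOutdegree_pos hG t i)
  have hwL : w ᵥ* adjMatrixR V ^ L = rho V ^ L • w := by
    rw [← mulVec_transpose, transpose_pow]
    exact pow_mulVec_eq_of_mulVec_eq (by rwa [mulVec_transpose]) L
  have hroot : ∀ q : ℝ, 0 ≤ q → (q ^ (1 / (L : ℝ))) ^ L = q := fun q hq => by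
    rw [one_div, Real.rpow_inv_natCast_pow hq hL.ne']
  rcases ht with ht | ht
  · refine mulVec_eq_of_smul_le hw hwL fun i => ?_
    rw [adjMatrixR_pow_mulVec_kOutdegree]
    have hq : (0 : ℝ) ≤ (kOutdegree (t + L) i : ℝ) / kOutdegree t i := by positivity
    refine (le_div_iff₀ (hd i)).1 ?_
    rw [← hroot _ hq]
    exact pow_le_pow_left₀ hρ.le (ht.symm.le.trans (Finset.inf'_le _ (Finset.mem_univ i))) L
  · refine mulVec_eq_of_le_smul hw hwL fun i => ?_
    rw [adjMatrixR_pow_mulVec_kOutdegree]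
    have hq : (0 : ℝ) ≤ (kOutdegree (t + L) i : ℝ) / kOutdegree t i := by positivity
    refine (div_le_iff₀ (hd i)).1 ?_
    rw [← hroot _ hq, ht]
    exact pow_le_pow_left₀ (by positivity)
      (Finset.le_sup' (fun i : V => ((kOutdegree (t + L) i : ℝ) / kOutdegree t i) ^ (1 / (L : ℝ)))
        (Finset.mem_univ i)) L

end FinDigraph

theorem mainTheorem3 (V : Type*) [Fintype V] [DecidableEq V] [Nonempty V]
    [Quiver V] [∀ i j : V, Fintype (i ⟶ j)]
    (hG : Quiver.IsSStronglyConnected V)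
    (L : ℕ) (hL : 0 < L) (t : ℕ)
    (ht : FinDigraph.lowerBound V L t = FinDigraph.rho V ∨
      FinDigraph.rho V = FinDigraph.upperBound V L t) :
    (∀ k : ℕ, t ≤ k →
      FinDigraph.lowerBound V L k = FinDigraph.rho V ∧
        FinDigraph.rho V = FinDigraph.upperBound V L k) ∧
    ∃ m : ℤ, FinDigraph.rho V ^ Nat.gcd L (FinDigraph.imprimitivityIndex V) = (m : ℝ) := by
  have heig := FinDigraph.kOutdegree_add_eq hG hL ht
  obtain ⟨hρ, w, hw, h⟩ := FinDigraph.exists_pos_vecMul_adjMatrixR_eq_rho hG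
  constructor
  · intro k hk
    obtain ⟨l, rfl⟩ := Nat.exists_eq_add_of_le hk
    -- Multiplying the eigenvector equation by `A ^ l` passes from `t` to `t + l`.
    have hl : (FinDigraph.adjMatrixR V ^ L *ᵥ fun i => (FinDigraph.kOutdegree (t + l) i : ℝ)) =
        FinDigraph.rho V ^ L • fun i => (FinDigraph.kOutdegree (t + l) i : ℝ) := by
      rw [← FinDigraph.adjMatrixR_pow_mulVec_kOutdegree, mulVec_mulVec,
        (Commute.pow_pow_self _ L l).eq, ← mulVec_mulVec, heig, mulVec_smul]
    have hq : ∀ i : V, ((FinDigraph.kOutdegree (t + l + L) i : ℝ) /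
        FinDigraph.kOutdegree (t + l) i) ^ (1 / (L : ℝ)) = FinDigraph.rho V := fun i => by
      rw [FinDigraph.adjMatrixR_pow_mulVec_kOutdegree] at hl
      have hi : (FinDigraph.kOutdegree (t + l + L) i : ℝ) =
        FinDigraph.rho V ^ L * FinDigraph.kOutdegree (t + l) i := congrFun hl i
      have hd : (FinDigraph.kOutdegree (t + l) i : ℝ) ≠ 0 :=
        Nat.cast_ne_zero.2 (FinDigraph.kOutdegree_pos hG _ i).ne'
      rw [hi, mul_div_cancel_right₀ _ hd, one_div, Real.pow_rpow_inv_natCast hρ.le hL.ne']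
    simp only [FinDigraph.lowerBound, FinDigraph.upperBound, hq, Finset.inf'_const,
      Finset.sup'_const, and_self]
  · set r := Nat.gcd L (FinDigraph.imprimitivityIndex V) with hr
    rw [FinDigraph.imprimitivityIndex, FinDigraph.adjMatrixC_eq_map_adjMatrixR] at hr
    have hxr := (FinDigraph.isIrreducible_adjMatrixR hG).pow_gcd_mulVec_eq hρ hw h hL heig hr
    obtain ⟨i⟩ := ‹Nonempty V›
    refine exists_int_eq_of_mulVec_eq (N := (FinDigraph.adjMatrix V ^ r).map (Nat.cast : ℕ → ℤ))
      (x := fun i => (FinDigraph.kOutdegree t i : ℤ)) (fun h0 => ?_) ?_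
    · exact (FinDigraph.kOutdegree_pos hG t i).ne' (Int.natCast_eq_zero.1 (congrFun h0 i))
    · rw [FinDigraph.adjMatrixR_pow] at hxr
      simpa [Function.comp_def, map_map] using hxr
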